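/- Let $L_1,L_2>0$, let $\Omega=(0,L_1)\times(0,L_2)$, let $m\ge 0$ be an integer, and put $\boldsymbol\Gamma=\{(x,y)\in\overline\Omega : x=0 \text{ or } y=0\}$. Let $H^m(\Omega)$ be the Sobolev space of real-valued $\theta\in L^2(\Omega)$ whose weak derivatives $\partial^\alpha\theta=\partial_x^{\alpha_1}\partial_y^{\alpha_2}\theta$ belong to $L^2(\Omega)$ for all $|\alpha|=\alpha_1+\alpha_2\le m$, with norm $\|\theta\|_{H^m(\Omega)}=\big(\sum_{|\alpha|\le m}\|\partial^\alpha\theta\|_{L^2(\Omega)}^2\big)^{1/2}$. Define $$\mathcal H^m_{\boldsymbol\Gamma}(\Omega)=\{\theta\in H^m(\Omega) : \partial^\alpha\theta|_{\boldsymbol\Gamma}=0 \text{ for all } |\alpha|\le m-1\},$$ with the norm of $H^m(\Omega)$, where $u|_{\boldsymbol\Gamma}=0$ means that the traces of $u$ on $\{x=0\}$ and on $\{y=0\}$ both vanish (for $m=0$ the condition is void and $\mathcal H^0_{\boldsymbol\Gamma}(\Omega)=L^2(\Omega)$). Here the trace of $u\in H^1(\Omega)$ on $\{x=0\}$ is the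 value at $x=0$ of its representative in $C([0,L_1];L^2(0,L_2))$, and similarly on $\{y=0\}$. Let $$\mathcal V_{\boldsymbol\Gamma}(\Omega)=\{\theta\in C^\infty(\overline\Omega) : \theta \text{ vanishes in a neighborhood of } \boldsymbol\Gamma\},$$ where $C^\infty(\overline\Omega)$ is the set of restrictions to $\overline\Omega$ of functions in $C^\infty(\mathbb R^2)$. Then $\mathcal V_{\boldsymbol\Gamma}(\Omega)\cap\mathcal H^m_{\boldsymbol\Gamma}(\Omega)$ is dense in $\mathcal H^m_{\boldsymbol\Gamma}(\Omega)$. -/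

import Mathlib

open MeasureTheory Set
open scoped ContDiff

noncomputable section

namespace RectangleSobolev

/-- The open rectangle `Ω = (0, L₁) × (0, L₂)`. -/
def rect (L₁ L₂ : ℝ) : Set (ℝ × ℝ) := Ioo 0 L₁ ×ˢ Ioo 0 L₂

/-- The part `Γ = {x = 0} ∪ {y = 0}` of the boundary of `Ω`. -/
def bdryGamma (L₁ L₂ : ℝ) : Set (ℝ × ℝ) :=
  {p | p ∈ closure (rect L₁ L₂) ∧ (p.1 = 0 ∨ p.2 = 0)}

/-- Classical partial derivative in `x`. -/
def dx (φ : ℝ × ℝ → ℝ) : ℝ × ℝ → ℝ := fun p => fderiv ℝ φ p (1, 0)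

/-- Classical partial derivative in `y`. -/
def dy (φ : ℝ × ℝ → ℝ) : ℝ × ℝ → ℝ := fun p => fderiv ℝ φ p (0, 1)

/-- Classical derivative `∂^α = ∂_x^{α₁} ∂_y^{α₂}`. -/
def partialD (α : ℕ × ℕ) (φ : ℝ × ℝ → ℝ) : ℝ × ℝ → ℝ := dx^[α.1] (dy^[α.2] φ)

/-- Test functions on `Ω`: smooth with compact support contained in `Ω`. -/
def IsTestFunction (L₁ L₂ : ℝ) (φ : ℝ × ℝ → ℝ) : Prop :=
  ContDiff ℝ ∞ φ ∧ HasCompactSupport φ ∧ tsupport φ ⊆ rect L₁ L₂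

/-- The real Hilbert space `L²(Ω)`. -/
abbrev L2 (L₁ L₂ : ℝ) : Type := Lp ℝ 2 ((volume : Measure (ℝ × ℝ)).restrict (rect L₁ L₂))

/-- `g` is the weak derivative `∂^α f` in `Ω`. -/
def HasWeakDeriv (L₁ L₂ : ℝ) (α : ℕ × ℕ) (f g : L2 L₁ L₂) : Prop :=
  ∀ φ : ℝ × ℝ → ℝ, IsTestFunction L₁ L₂ φ →
    ∫ p in rect L₁ L₂, f p * partialD α φ p
      = (-1) ^ (α.1 + α.2) * ∫ p in rect L₁ L₂, g p * φ p

/-- The multi-indices `α` with `|α| ≤ m`. -/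
def multiIdx (m : ℕ) : Finset (ℕ × ℕ) :=
  (Finset.range (m + 1) ×ˢ Finset.range (m + 1)).filter fun α => α.1 + α.2 ≤ m

theorem mem_multiIdx {m : ℕ} {α : ℕ × ℕ} : α ∈ multiIdx m ↔ α.1 + α.2 ≤ m := by
  simp only [multiIdx, Finset.mem_filter, Finset.mem_product, Finset.mem_range]
  omega

/-- The zero multi-index. -/
def zeroIdx (m : ℕ) : multiIdx m := ⟨(0, 0), mem_multiIdx.2 (Nat.zero_le m)⟩

theorem contDiff_dx {φ : ℝ × ℝ → ℝ} (h : ContDiff ℝ ∞ φ) : ContDiff ℝ ∞ (dx φ) :=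
  (h.fderiv_right (m := ∞) (by simp)).clm_apply contDiff_const

theorem contDiff_dy {φ : ℝ × ℝ → ℝ} (h : ContDiff ℝ ∞ φ) : ContDiff ℝ ∞ (dy φ) :=
  (h.fderiv_right (m := ∞) (by simp)).clm_apply contDiff_const

theorem hasCompactSupport_dx {φ : ℝ × ℝ → ℝ} (h : HasCompactSupport φ) :
    HasCompactSupport (dx φ) := h.fderiv_apply ℝ (1, 0)

theorem hasCompactSupport_dy {φ : ℝ × ℝ → ℝ} (h : HasCompactSupport φ) :
    HasCompactSupport (dy φ) := h.fderiv_apply ℝ (0, 1)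

theorem partialD_regular (α : ℕ × ℕ) {φ : ℝ × ℝ → ℝ} (h : ContDiff ℝ ∞ φ)
    (hc : HasCompactSupport φ) :
    ContDiff ℝ ∞ (partialD α φ) ∧ HasCompactSupport (partialD α φ) := by
  have hy : ∀ n : ℕ, ContDiff ℝ ∞ (dy^[n] φ) ∧ HasCompactSupport (dy^[n] φ) := by
    intro n
    induction n with
    | zero => exact ⟨h, hc⟩
    | succ n ih =>
      rw [Function.iterate_succ_apply']
      exact ⟨contDiff_dy ih.1, hasCompactSupport_dy ih.2⟩
  have hx : ∀ k n : ℕ, ContDiff ℝ ∞ (dx^[k] (dy^[n] φ)) ∧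
      HasCompactSupport (dx^[k] (dy^[n] φ)) := by
    intro k n
    induction k with
    | zero => exact hy n
    | succ k ih =>
      rw [Function.iterate_succ_apply']
      exact ⟨contDiff_dx ih.1, hasCompactSupport_dx ih.2⟩
  exact hx α.1 α.2

theorem integrable_mul_of_test {L₁ L₂ : ℝ} (f : L2 L₁ L₂) {φ : ℝ × ℝ → ℝ}
    (h : Continuous φ) (hc : HasCompactSupport φ) :
    Integrable (fun p => f p * φ p) (volume.restrict (rect L₁ L₂)) :=
  MemLp.integrable_mul (p := 2) (q := 2) (Lp.memLp f) (h.memLp_of_hasCompactSupport hc)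

theorem HasWeakDeriv.zero (L₁ L₂ : ℝ) (α : ℕ × ℕ) : HasWeakDeriv L₁ L₂ α 0 0 := by
  intro φ _
  have h0 : ∀ ψ : ℝ × ℝ → ℝ, ∫ p in rect L₁ L₂, (0 : L2 L₁ L₂) p * ψ p = 0 := by
    intro ψ
    refine integral_eq_zero_of_ae ?_
    filter_upwards [Lp.coeFn_zero ℝ 2 ((volume : Measure (ℝ × ℝ)).restrict (rect L₁ L₂))]
      with p hp
    rw [hp, Pi.zero_apply, zero_mul]
  rw [h0, h0, mul_zero]

theorem HasWeakDeriv.add {L₁ L₂ : ℝ} {α : ℕ × ℕ} {f g f' g' : L2 L₁ L₂}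
    (h : HasWeakDeriv L₁ L₂ α f g) (h' : HasWeakDeriv L₁ L₂ α f' g') :
    HasWeakDeriv L₁ L₂ α (f + f') (g + g') := by
  intro φ hφ
  have key : ∀ (u v : L2 L₁ L₂) {ψ : ℝ × ℝ → ℝ}, Continuous ψ → HasCompactSupport ψ →
      ∫ p in rect L₁ L₂, (u + v : L2 L₁ L₂) p * ψ p
        = (∫ p in rect L₁ L₂, u p * ψ p) + ∫ p in rect L₁ L₂, v p * ψ p := by
    intro u v ψ hψ hc
    rw [← integral_add (integrable_mul_of_test u hψ hc) (integrable_mul_of_test v hψ hc)]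
    refine integral_congr_ae ?_
    filter_upwards [Lp.coeFn_add u v] with p hp
    rw [hp, Pi.add_apply, add_mul]
  have hD := partialD_regular α hφ.1 hφ.2.1
  rw [key f f' hD.1.continuous hD.2, key g g' hφ.1.continuous hφ.2.1, h φ hφ, h' φ hφ, mul_add]

theorem HasWeakDeriv.smul {L₁ L₂ : ℝ} {α : ℕ × ℕ} {f g : L2 L₁ L₂} (c : ℝ)
    (h : HasWeakDeriv L₁ L₂ α f g) : HasWeakDeriv L₁ L₂ α (c • f) (c • g) := by
  intro φ hφ
  have key : ∀ (u : L2 L₁ L₂) (ψ : ℝ × ℝ → ℝ),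
      ∫ p in rect L₁ L₂, (c • u : L2 L₁ L₂) p * ψ p = c * ∫ p in rect L₁ L₂, u p * ψ p := by
    intro u ψ
    rw [← integral_const_mul]
    refine integral_congr_ae ?_
    filter_upwards [Lp.coeFn_smul c u] with p hp
    rw [hp, Pi.smul_apply, smul_eq_mul, mul_assoc]
  rw [key, key, h φ hφ, mul_left_comm]

/-- The Sobolev space `H^m(Ω)`. A function `θ ∈ L²(Ω)` all of whose weak derivatives `∂^α θ`,
`|α| ≤ m`, lie in `L²(Ω)` is represented by the family `(∂^α θ)_{|α| ≤ m}`, which `θ` (the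
component of index `0`) determines uniquely. The norm inherited from the `ℓ²`-sum of copies of
`L²(Ω)` is `‖θ‖ = (∑_{|α| ≤ m} ‖∂^α θ‖²_{L²(Ω)})^{1/2}`. -/
def sobolevH (m : ℕ) (L₁ L₂ : ℝ) : Submodule ℝ (PiLp 2 fun _ : multiIdx m => L2 L₁ L₂) where
  carrier := {F | ∀ α : multiIdx m, HasWeakDeriv L₁ L₂ α (F (zeroIdx m)) (F α)}
  zero_mem' := fun α => HasWeakDeriv.zero L₁ L₂ α
  add_mem' := fun h h' α => (h α).add (h' α)
  smul_mem' := fun c _ h α => (h α).smul c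

/-- The underlying function of an element of `H^m(Ω)`. -/
def toL2 {m : ℕ} {L₁ L₂ : ℝ} (θ : sobolevH m L₁ L₂) : L2 L₁ L₂ := θ.1 (zeroIdx m)

/-- The weak derivative `∂^α θ`, `|α| ≤ m`, of an element of `H^m(Ω)`. -/
def weakD {m : ℕ} {L₁ L₂ : ℝ} (θ : sobolevH m L₁ L₂) (α : multiIdx m) : L2 L₁ L₂ := θ.1 α

/-- The space `L²(0, L)` on one side of the rectangle. -/
abbrev L2Side (L : ℝ) : Type := Lp ℝ 2 ((volume : Measure ℝ).restrict (Ioo 0 L))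

/-- `g` is the trace of `u` on the side `{x = 0}`: `u` has a representative in
`C_x([0, L₁]; L²_y(0, L₂))` (every `u ∈ H¹(Ω)` does) and `g` is its value at `x = 0`. -/
def HasTraceLeft (L₁ L₂ : ℝ) (u : L2 L₁ L₂) (g : L2Side L₂) : Prop :=
  ∃ U : ℝ → L2Side L₂, ContinuousOn U (Icc 0 L₁) ∧
    (∀ᵐ x ∂(volume : Measure ℝ).restrict (Ioo 0 L₁),
      ∀ᵐ y ∂(volume : Measure ℝ).restrict (Ioo 0 L₂), U x y = u (x, y)) ∧
    U 0 = g

/-- `g` is the trace of `u` on the side `{y = 0}`: `u` has a representative in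
`C_y([0, L₂]; L²_x(0, L₁))` (every `u ∈ H¹(Ω)` does) and `g` is its value at `y = 0`. -/
def HasTraceBottom (L₁ L₂ : ℝ) (u : L2 L₁ L₂) (g : L2Side L₁) : Prop :=
  ∃ U : ℝ → L2Side L₁, ContinuousOn U (Icc 0 L₂) ∧
    (∀ᵐ y ∂(volume : Measure ℝ).restrict (Ioo 0 L₂),
      ∀ᵐ x ∂(volume : Measure ℝ).restrict (Ioo 0 L₁), U y x = u (x, y)) ∧
    U 0 = g

/-- `u|_Γ = 0`, that is, `u|_{x=0} = 0` and `u|_{y=0} = 0` in the sense of traces. -/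
def VanishesOnGamma (L₁ L₂ : ℝ) (u : L2 L₁ L₂) : Prop :=
  HasTraceLeft L₁ L₂ u 0 ∧ HasTraceBottom L₁ L₂ u 0

theorem ae_ae_left {L₁ L₂ : ℝ} {P : ℝ × ℝ → Prop}
    (h : ∀ᵐ p ∂(volume : Measure (ℝ × ℝ)).restrict (rect L₁ L₂), P p) :
    ∀ᵐ x ∂(volume : Measure ℝ).restrict (Ioo 0 L₁),
      ∀ᵐ y ∂(volume : Measure ℝ).restrict (Ioo 0 L₂), P (x, y) := by
  rw [rect, Measure.volume_eq_prod, ← Measure.prod_restrict] at h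
  exact Measure.ae_ae_of_ae_prod h

theorem ae_ae_bottom {L₁ L₂ : ℝ} {P : ℝ × ℝ → Prop}
    (h : ∀ᵐ p ∂(volume : Measure (ℝ × ℝ)).restrict (rect L₁ L₂), P p) :
    ∀ᵐ y ∂(volume : Measure ℝ).restrict (Ioo 0 L₂),
      ∀ᵐ x ∂(volume : Measure ℝ).restrict (Ioo 0 L₁), P (x, y) := by
  rw [rect, Measure.volume_eq_prod, ← Measure.prod_restrict] at h
  exact Measure.ae_ae_of_ae_prod (Measure.measurePreserving_swap.quasiMeasurePreserving.ae h)

theorem VanishesOnGamma.zero (L₁ L₂ : ℝ) : VanishesOnGamma L₁ L₂ 0 := by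
  have h := Lp.coeFn_zero ℝ 2 ((volume : Measure (ℝ × ℝ)).restrict (rect L₁ L₂))
  constructor
  · refine ⟨fun _ => 0, continuousOn_const, ?_, rfl⟩
    filter_upwards [ae_ae_left h] with x hx
    filter_upwards [hx, Lp.coeFn_zero ℝ 2 ((volume : Measure ℝ).restrict (Ioo 0 L₂))]
      with y h1 h2
    rw [h2, h1, Pi.zero_apply, Pi.zero_apply]
  · refine ⟨fun _ => 0, continuousOn_const, ?_, rfl⟩
    filter_upwards [ae_ae_bottom h] with y hy
    filter_upwards [hy, Lp.coeFn_zero ℝ 2 ((volume : Measure ℝ).restrict (Ioo 0 L₁))]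
      with x h1 h2
    rw [h2, h1, Pi.zero_apply, Pi.zero_apply]

theorem VanishesOnGamma.add {L₁ L₂ : ℝ} {u v : L2 L₁ L₂} (hu : VanishesOnGamma L₁ L₂ u)
    (hv : VanishesOnGamma L₁ L₂ v) : VanishesOnGamma L₁ L₂ (u + v) := by
  have h := Lp.coeFn_add u v
  obtain ⟨⟨U, hU, hUu, hU0⟩, ⟨U', hU', hUu', hU0'⟩⟩ := hu
  obtain ⟨⟨V, hV, hVv, hV0⟩, ⟨V', hV', hVv', hV0'⟩⟩ := hv
  constructor
  · refine ⟨fun x => U x + V x, hU.add hV, ?_, by simp [hU0, hV0]⟩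
    filter_upwards [ae_ae_left h, hUu, hVv] with x h1 h2 h3
    filter_upwards [h1, h2, h3, Lp.coeFn_add (U x) (V x)] with y g1 g2 g3 g4
    rw [g4, g1, Pi.add_apply, Pi.add_apply, g2, g3]
  · refine ⟨fun y => U' y + V' y, hU'.add hV', ?_, by simp [hU0', hV0']⟩
    filter_upwards [ae_ae_bottom h, hUu', hVv'] with y h1 h2 h3
    filter_upwards [h1, h2, h3, Lp.coeFn_add (U' y) (V' y)] with x g1 g2 g3 g4
    rw [g4, g1, Pi.add_apply, Pi.add_apply, g2, g3]

theorem VanishesOnGamma.smul {L₁ L₂ : ℝ} {u : L2 L₁ L₂} (c : ℝ)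
    (hu : VanishesOnGamma L₁ L₂ u) : VanishesOnGamma L₁ L₂ (c • u) := by
  have h := Lp.coeFn_smul c u
  obtain ⟨⟨U, hU, hUu, hU0⟩, ⟨U', hU', hUu', hU0'⟩⟩ := hu
  constructor
  · refine ⟨fun x => c • U x, hU.const_smul c, ?_, by simp [hU0]⟩
    filter_upwards [ae_ae_left h, hUu] with x h1 h2
    filter_upwards [h1, h2, Lp.coeFn_smul c (U x)] with y g1 g2 g4
    rw [g4, g1, Pi.smul_apply, Pi.smul_apply, g2]
  · refine ⟨fun y => c • U' y, hU'.const_smul c, ?_, by simp [hU0']⟩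
    filter_upwards [ae_ae_bottom h, hUu'] with y h1 h2
    filter_upwards [h1, h2, Lp.coeFn_smul c (U' y)] with x g1 g2 g4
    rw [g4, g1, Pi.smul_apply, Pi.smul_apply, g2]

/-- `H^m_Γ(Ω) = {θ ∈ H^m(Ω) : (∂^α θ)|_Γ = 0 for all |α| ≤ m - 1}`, with the norm of `H^m(Ω)`.
The condition `|α| ≤ m - 1` reads `|α| < m`; it is void for `m = 0`. -/
def sobolevHGamma (m : ℕ) (L₁ L₂ : ℝ) : Submodule ℝ (sobolevH m L₁ L₂) where
  carrier := {θ | ∀ α : multiIdx m, α.1.1 + α.1.2 < m → VanishesOnGamma L₁ L₂ (weakD θ α)}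
  zero_mem' := fun _ _ => VanishesOnGamma.zero L₁ L₂
  add_mem' := fun h h' α hα => (h α hα).add (h' α hα)
  smul_mem' := fun c _ h α hα => (h α hα).smul c

/-- `V_Γ(Ω)`: functions of class `C^∞` up to the boundary (restrictions to the closed rectangle
of smooth functions on the plane) that vanish in a neighborhood of `Γ`. -/
def smoothVanishing (L₁ L₂ : ℝ) : Set (ℝ × ℝ → ℝ) :=
  {φ | ContDiff ℝ ∞ φ ∧
    ∃ O : Set (ℝ × ℝ), IsOpen O ∧ bdryGamma L₁ L₂ ⊆ O ∧
      ∀ p ∈ O ∩ closure (rect L₁ L₂), φ p = 0}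

/-- `V_Γ(Ω) ∩ H^m_Γ(Ω)`, as a subset of `H^m_Γ(Ω)`. -/
def smoothVanishingInH (m : ℕ) (L₁ L₂ : ℝ) : Set (sobolevHGamma m L₁ L₂) :=
  {θ | ∃ φ ∈ smoothVanishing L₁ L₂,
    ∀ᵐ p ∂(volume : Measure (ℝ × ℝ)).restrict (rect L₁ L₂), toL2 θ.1 p = φ p}

end RectangleSobolev

end

open Filter Topology
open scoped ENNReal

namespace RectangleSobolev

/-! Extend `θ` by zero outside `Ω` and convolve with a kernel `η` supported in `[δ, 3δ]²`. The
result is smooth and vanishes where `x < δ` or `y < δ`, so it lies in `V_Γ`. It remains to see that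
it is close to `θ` in `H^m(Ω)`.

For `p ∈ Ω` the function `t ↦ η (p - t)` is supported away from `x = L₁` and `y = L₂`, but may cross
`Γ`, so it is not a test function on `Ω`. The vanishing traces make up for this. Cut off at distance
`1/n` from `Γ`: the error is the integral of `u` times the gradient of the cutoff, which is `O(n)`
on a strip of width `O(1/n)`. A zero trace makes the `L¹` norm of `u` on that strip `o(1/n)`
(`tendsto_mul_lintegral_strip`), so the error disappears. One derivative at a time, this gives
`integral_mul_partialD_of_cornerTest`. Hence on `Ω` differentiation commutes with the mollification
of the zero extensions (`partialD_mollify_eq_mollify`).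

Each derivative then converges in `L²` by continuity of translations
(`tendsto_eLpNorm_translate_sub`, `eLpNorm_convolution_sub_le`). -/

/-! ### Translations and averages in `L²` of the plane. -/

theorem tendsto_eLpNorm_translate_sub {g : ℝ × ℝ → ℝ} (hg : MemLp g 2 volume) :
    Tendsto (fun t : ℝ × ℝ => eLpNorm (fun p => g (p - t) - g p) 2 volume) (𝓝 0) (𝓝 0) := by
  have hmp : ∀ t : ℝ × ℝ, MeasurePreserving (fun p : ℝ × ℝ => p - t) :=
    fun t => measurePreserving_sub_right volume t
  -- Currying makes `t ↦ (p ↦ p - t)` continuous for the compact-open topology, as continuity of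
  -- composition on `Lp` requires.
  let c : C((ℝ × ℝ) × (ℝ × ℝ), ℝ × ℝ) := ⟨fun q => q.2 - q.1, by fun_prop⟩
  have h1 : Continuous fun t : ℝ × ℝ =>
      Lp.compMeasurePreserving (fun p : ℝ × ℝ => p - t) (hmp t) (hg.toLp g) :=
    (continuous_const (y := hg.toLp g)).compMeasurePreservingLp c.curry.continuous hmp (by simp)
  have h2 := h1.tendsto 0
  rw [Lp.tendsto_Lp_iff_tendsto_eLpNorm'] at h2
  refine h2.congr fun t => eLpNorm_congr_ae ?_
  filter_upwards [Lp.coeFn_compMeasurePreserving (hg.toLp g) (hmp t),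
    Lp.coeFn_compMeasurePreserving (hg.toLp g) (hmp 0), hg.coeFn_toLp,
    (hmp t).quasiMeasurePreserving.ae hg.coeFn_toLp] with p e1 e2 e3 e4
  rw [Pi.sub_apply, e1, e2]
  simp only [Function.comp, sub_zero, e3, e4]

/-- Jensen's inequality for the probability measure `ν`, then Tonelli. -/
theorem lintegral_sq_average_translate_sub_le {g : ℝ × ℝ → ℝ} (hg : Measurable g)
    (ν : Measure (ℝ × ℝ)) [IsProbabilityMeasure ν] {ε : ℝ≥0∞}
    (h : ∀ᵐ t ∂ν, eLpNorm (fun p => g (p - t) - g p) 2 volume ≤ ε) :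
    ∫⁻ p, (∫⁻ t, ‖g (p - t) - g p‖ₑ ∂ν) ^ 2 ≤ ε ^ 2 := by
  have hm : Measurable fun q : (ℝ × ℝ) × (ℝ × ℝ) => ‖g (q.1 - q.2) - g q.1‖ₑ ^ 2 := by
    have h1 : Measurable fun q : (ℝ × ℝ) × (ℝ × ℝ) => g (q.1 - q.2) := hg.comp (by fun_prop)
    have h2 : Measurable fun q : (ℝ × ℝ) × (ℝ × ℝ) => g q.1 := hg.comp (by fun_prop)
    exact (h1.sub h2).enorm.pow_const 2
  have hsq : ∀ (μ : Measure (ℝ × ℝ)) (f : ℝ × ℝ → ℝ),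
      eLpNorm f 2 μ ^ 2 = ∫⁻ x, ‖f x‖ₑ ^ 2 ∂μ := by
    intro μ f
    have := eLpNorm_nnreal_pow_eq_lintegral (μ := μ) (f := f) (p := 2) (by norm_num)
    simpa using this
  calc ∫⁻ p, (∫⁻ t, ‖g (p - t) - g p‖ₑ ∂ν) ^ 2
      ≤ ∫⁻ p, ∫⁻ t, ‖g (p - t) - g p‖ₑ ^ 2 ∂ν := by
        refine lintegral_mono fun p => ?_
        have hp : Measurable fun t : ℝ × ℝ => g (p - t) - g p :=
          (hg.comp (by fun_prop)).sub measurable_const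
        rw [← hsq ν, ← eLpNorm_one_eq_lintegral_enorm]
        exact pow_le_pow_left' (eLpNorm_le_eLpNorm_of_exponent_le (by norm_num)
          hp.aestronglyMeasurable) 2
    _ = ∫⁻ t, ∫⁻ p, ‖g (p - t) - g p‖ₑ ^ 2 ∂volume ∂ν :=
        lintegral_lintegral_swap hm.aemeasurable
    _ ≤ ∫⁻ _, ε ^ 2 ∂ν := by
        refine lintegral_mono_ae ?_
        filter_upwards [h] with t ht
        rw [← hsq volume]
        exact pow_le_pow_left' ht 2
    _ = ε ^ 2 := by simp

/-- With `ν = η dt` a probability measure, the convolution minus `g` is the `ν`-average of `g (p -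
t) - g p`. Only translations by `t` with `η t ≠ 0` are seen by `ν`. -/
theorem eLpNorm_convolution_sub_le {g η : ℝ × ℝ → ℝ} (hg : Measurable g)
    (hgi : LocallyIntegrable g volume) (hη : Continuous η) (hηc : HasCompactSupport η)
    (hη0 : ∀ t, 0 ≤ η t) (hη1 : ∫ t, η t = 1) {ε : ℝ≥0∞}
    (h : ∀ t, η t ≠ 0 → eLpNorm (fun p => g (p - t) - g p) 2 volume ≤ ε) :
    eLpNorm (fun p => (∫ t, g t * η (p - t)) - g p) 2 volume ≤ ε := by
  have hηi : Integrable η := hη.integrable_of_hasCompactSupport hηc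
  have hw : Measurable fun t => ENNReal.ofReal (η t) := hη.measurable.ennreal_ofReal
  let ν : Measure (ℝ × ℝ) := volume.withDensity fun t => ENNReal.ofReal (η t)
  have : IsProbabilityMeasure ν := by
    refine ⟨?_⟩
    rw [withDensity_apply _ MeasurableSet.univ, setLIntegral_univ,
      ← ofReal_integral_eq_lintegral_ofReal hηi (ae_of_all _ hη0), hη1, ENNReal.ofReal_one]
  have hν : ∀ᵐ t ∂ν, eLpNorm (fun p => g (p - t) - g p) 2 volume ≤ ε := by
    rw [ae_withDensity_iff hw]
    refine ae_of_all _ fun t ht => h t fun h0 => ht ?_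
    rw [h0, ENNReal.ofReal_zero]
  have key := lintegral_sq_average_translate_sub_le hg ν hν
  have hpt : ∀ p, ‖(∫ t, g t * η (p - t)) - g p‖ₑ ≤ ∫⁻ t, ‖g (p - t) - g p‖ₑ ∂ν := by
    intro p
    have e1 : ∫ t, g t * η (p - t) = ∫ t, g (p - t) * η t := by
      rw [← integral_sub_left_eq_self (fun t => g t * η (p - t)) volume p]
      simp
    have i1 : Integrable fun t => g (p - t) * η t := by
      have hc := hηc.convolutionExists_right (ContinuousLinearMap.mul ℝ ℝ) hgi hη p
      have := hc.integrable_swap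
      simpa [ConvolutionExistsAt] using this
    have e2 : (∫ t, g t * η (p - t)) - g p = ∫ t, (g (p - t) - g p) * η t := by
      have : ∫ t, g p * η t = g p := by rw [integral_const_mul, hη1, mul_one]
      rw [e1]
      conv_lhs => rw [← this]
      rw [← integral_sub i1 (hηi.const_mul _)]
      simp only [sub_mul]
    rw [e2]
    refine (enorm_integral_le_lintegral_enorm _).trans (le_of_eq ?_)
    have hp : Measurable fun t : ℝ × ℝ => ‖g (p - t) - g p‖ₑ :=
      ((hg.comp (by fun_prop)).sub measurable_const).enorm
    rw [lintegral_withDensity_eq_lintegral_mul _ hw hp]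
    refine lintegral_congr fun t => ?_
    rw [enorm_mul, Pi.mul_apply, mul_comm, Real.enorm_eq_ofReal (hη0 t)]
  have h2 : eLpNorm (fun p => (∫ t, g t * η (p - t)) - g p) 2 volume ^ 2 ≤ ε ^ 2 := by
    have := eLpNorm_nnreal_pow_eq_lintegral (μ := (volume : Measure (ℝ × ℝ)))
      (f := fun p => (∫ t, g t * η (p - t)) - g p) (p := 2) (by norm_num)
    have h3 : eLpNorm (fun p => (∫ t, g t * η (p - t)) - g p) 2 volume ^ 2
        = ∫⁻ p, ‖(∫ t, g t * η (p - t)) - g p‖ₑ ^ 2 := by simpa using this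
    rw [h3]
    exact (lintegral_mono fun p => pow_le_pow_left' (hpt p) 2).trans key
  exact (ENNReal.pow_le_pow_left_iff two_ne_zero).1 h2

/-! ### Zero traces and cutoffs near `Γ`. -/

/-- By Cauchy–Schwarz in `y`, the `L¹` norm of a slice is at most `√b ‖U x‖`, which is small near `x
= 0` because `U` is continuous there with `U 0 = 0`. The factor `n` compensates exactly for the
width `3 / n`. No derivative of `u` and no Hardy inequality enters. -/
theorem tendsto_mul_lintegral_strip {a b : ℝ} (ha : 0 < a) {u : ℝ × ℝ → ℝ}
    (hu : AEMeasurable u (volume.restrict (rect a b))) {U : ℝ → L2Side b}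
    (hU : ContinuousOn U (Icc 0 a))
    (hUu : ∀ᵐ x ∂(volume : Measure ℝ).restrict (Ioo 0 a),
      ∀ᵐ y ∂(volume : Measure ℝ).restrict (Ioo 0 b), U x y = u (x, y))
    (hU0 : U 0 = 0) :
    Tendsto (fun n : ℕ => (n : ℝ≥0∞) * ∫⁻ p in Ioo 0 (3 / (n : ℝ)) ×ˢ Ioo 0 b, ‖u p‖ₑ)
      atTop (𝓝 0) := by
  set K : ℝ≥0∞ := (volume.restrict (Ioo 0 b)) univ ^ (1 / 2 : ℝ) with hK
  have hKtop : K ≠ ⊤ := by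
    rw [hK]
    exact ENNReal.rpow_ne_top_of_nonneg (by norm_num : (0 : ℝ) ≤ 1 / 2) (measure_ne_top _ _)
  rw [ENNReal.tendsto_nhds_zero]
  intro ε hε
  obtain ⟨δ, hδ, hδε⟩ := ENNReal.exists_nnreal_pos_mul_lt
    (ENNReal.mul_ne_top ENNReal.ofNat_ne_top hKtop : (3 : ℝ≥0∞) * K ≠ ⊤) hε.ne'
  have hcont := hU 0 ⟨le_rfl, ha.le⟩
  obtain ⟨r, hr, hrU⟩ := Metric.continuousWithinAt_iff.1 hcont δ hδ
  have hlim : Tendsto (fun n : ℕ => 3 / (n : ℝ)) atTop (𝓝 0) :=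
    tendsto_const_div_atTop_nhds_zero_nat 3
  filter_upwards [hlim.eventually (gt_mem_nhds hr), hlim.eventually (gt_mem_nhds ha),
    eventually_gt_atTop 0] with n hnr hna hn
  have hsub : Ioo 0 (3 / (n : ℝ)) ⊆ Ioo 0 a := Ioo_subset_Ioo_right hna.le
  have hmeas : AEMeasurable (fun p => ‖u p‖ₑ)
      ((volume.restrict (Ioo 0 (3 / (n : ℝ)))).prod (volume.restrict (Ioo 0 b))) := by
    rw [Measure.prod_restrict, ← Measure.volume_eq_prod]
    exact (hu.mono_measure (Measure.restrict_mono (prod_mono_left hsub) le_rfl)).enorm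
  have hin : ∀ᵐ x ∂(volume : Measure ℝ).restrict (Ioo 0 (3 / (n : ℝ))),
      ∫⁻ y in Ioo 0 b, ‖u (x, y)‖ₑ ≤ δ * K := by
    filter_upwards [ae_restrict_of_ae_restrict_of_subset hsub hUu,
      ae_restrict_mem measurableSet_Ioo] with x hx hxm
    have e1 : ∫⁻ y in Ioo 0 b, ‖u (x, y)‖ₑ = eLpNorm (U x) 1 (volume.restrict (Ioo 0 b)) := by
      rw [eLpNorm_one_eq_lintegral_enorm]
      refine lintegral_congr_ae ?_
      filter_upwards [hx] with y hy
      rw [hy]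
    have e2 := eLpNorm_le_eLpNorm_mul_rpow_measure_univ (p := 1) (q := 2) (by norm_num)
      (Lp.aestronglyMeasurable (U x))
    have e3 : eLpNorm (U x) 2 (volume.restrict (Ioo 0 b)) ≤ δ := by
      rw [← Lp.enorm_def]
      have h1 := hrU (hsub.trans Ioo_subset_Icc_self hxm)
        (by rw [Real.dist_eq, sub_zero, abs_of_pos hxm.1]; exact hxm.2.trans hnr)
      rw [hU0, dist_zero_right] at h1
      rw [← ofReal_norm, ← ENNReal.ofReal_coe_nnreal]
      exact ENNReal.ofReal_le_ofReal h1.le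
    rw [e1]
    refine e2.trans ?_
    have e4 : (1 / (1 : ℝ≥0∞).toReal - 1 / (2 : ℝ≥0∞).toReal) = (1 / 2 : ℝ) := by norm_num
    rw [e4]
    gcongr
  have hn0 : (n : ℝ≥0∞) ≠ 0 := by exact_mod_cast hn.ne'
  calc (n : ℝ≥0∞) * ∫⁻ p in Ioo 0 (3 / (n : ℝ)) ×ˢ Ioo 0 b, ‖u p‖ₑ
      = n * ∫⁻ x in Ioo 0 (3 / (n : ℝ)), ∫⁻ y in Ioo 0 b, ‖u (x, y)‖ₑ := by
        rw [Measure.volume_eq_prod, ← Measure.prod_restrict, lintegral_prod _ hmeas]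
    _ ≤ n * ∫⁻ _ in Ioo 0 (3 / (n : ℝ)), δ * K := by
        gcongr n * ?_
        exact lintegral_mono_ae hin
    _ = δ * (3 * K) := by
        rw [lintegral_const, Measure.restrict_apply_univ, Real.volume_Ioo, sub_zero,
          ENNReal.ofReal_div_of_pos (by positivity), ENNReal.ofReal_natCast,
          ENNReal.ofReal_ofNat]
        rw [mul_comm, mul_assoc, ENNReal.div_mul_cancel hn0 (ENNReal.natCast_ne_top n)]
        ring
    _ ≤ ε := hδε.le

/-- A smooth function that vanishes for `x ≤ 1/n` or `y ≤ 1/n` and equals `1` for `x, y ≥ 2/n`. -/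
noncomputable def cutoff (n : ℕ) (p : ℝ × ℝ) : ℝ :=
  Real.smoothTransition (n * p.1 - 1) * Real.smoothTransition (n * p.2 - 1)

theorem contDiff_cutoff (n : ℕ) : ContDiff ℝ ∞ (cutoff n) := by
  have h : ContDiff ℝ ∞ Real.smoothTransition := Real.smoothTransition.contDiff
  exact (h.comp (by fun_prop)).mul (h.comp (by fun_prop))

theorem cutoff_nonneg (n : ℕ) (p : ℝ × ℝ) : 0 ≤ cutoff n p :=
  mul_nonneg (Real.smoothTransition.nonneg _) (Real.smoothTransition.nonneg _)

theorem cutoff_le_one (n : ℕ) (p : ℝ × ℝ) : cutoff n p ≤ 1 :=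
  mul_le_one₀ (Real.smoothTransition.le_one _) (Real.smoothTransition.nonneg _)
    (Real.smoothTransition.le_one _)

theorem tsupport_cutoff_subset (n : ℕ) :
    tsupport (cutoff n) ⊆ {p | 1 ≤ n * p.1 ∧ 1 ≤ n * p.2} := by
  refine closure_minimal (fun p hp => ?_) ?_
  · rw [Function.mem_support, cutoff, mul_ne_zero_iff] at hp
    have h1 := mt Real.smoothTransition.zero_of_nonpos hp.1
    have h2 := mt Real.smoothTransition.zero_of_nonpos hp.2
    constructor <;> linarith
  · have c1 : Continuous fun p : ℝ × ℝ => (n : ℝ) * p.1 := by fun_prop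
    have c2 : Continuous fun p : ℝ × ℝ => (n : ℝ) * p.2 := by fun_prop
    exact (isClosed_le continuous_const c1).inter (isClosed_le continuous_const c2)

theorem tendsto_cutoff {p : ℝ × ℝ} (h1 : 0 < p.1) (h2 : 0 < p.2) :
    Tendsto (fun n => cutoff n p) atTop (𝓝 1) := by
  have key : ∀ {x : ℝ}, 0 < x → ∀ᶠ n : ℕ in atTop, (2 : ℝ) ≤ n * x := fun hx =>
    (tendsto_natCast_atTop_atTop.atTop_mul_const hx).eventually_ge_atTop 2
  refine tendsto_const_nhds.congr' ?_
  filter_upwards [key h1, key h2] with n hn1 hn2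
  rw [cutoff, Real.smoothTransition.one_of_one_le (by linarith),
    Real.smoothTransition.one_of_one_le (by linarith), mul_one]

theorem deriv_smoothTransition_of_one_lt {z : ℝ} (hz : 1 < z) :
    deriv Real.smoothTransition z = 0 := by
  have : Real.smoothTransition =ᶠ[𝓝 z] fun _ => 1 := by
    filter_upwards [lt_mem_nhds hz] with w hw
    exact Real.smoothTransition.one_of_one_le hw.le
  rw [this.deriv_eq, deriv_const]

/-- Compactness gives the bound on `[-1, 2]`, and the derivative is zero beyond `1`. The range `z ≥
-1` covers `n * x - 1` for `x > 0`. -/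
theorem exists_abs_deriv_smoothTransition_le :
    ∃ C : ℝ, 0 ≤ C ∧ ∀ z, -1 ≤ z → |deriv Real.smoothTransition z| ≤ C := by
  have hc : Continuous (deriv Real.smoothTransition) :=
    (Real.smoothTransition.contDiff (n := 1)).continuous_deriv le_rfl
  obtain ⟨C, hC⟩ := (isCompact_Icc (a := (-1 : ℝ)) (b := 2)).exists_bound_of_continuousOn
    hc.continuousOn
  refine ⟨C, (norm_nonneg _).trans (hC 0 (by norm_num)), fun z hz => ?_⟩
  rcases le_or_gt z 2 with h | h
  · exact hC z ⟨hz, h⟩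
  · rw [deriv_smoothTransition_of_one_lt (by linarith), abs_zero]
    exact (norm_nonneg _).trans (hC 0 (by norm_num))

theorem fderiv_cutoff (n : ℕ) (p e : ℝ × ℝ) :
    fderiv ℝ (cutoff n) p e =
      Real.smoothTransition (n * p.1 - 1) * (deriv Real.smoothTransition (n * p.2 - 1) * (n * e.2))
      + deriv Real.smoothTransition (n * p.1 - 1) * (n * e.1)
        * Real.smoothTransition (n * p.2 - 1) := by
  have hd : ∀ z, HasDerivAt Real.smoothTransition (deriv Real.smoothTransition z) z := fun z =>
    ((Real.smoothTransition.contDiff (n := 1)).differentiable (by simp) z).hasDerivAt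
  have a1 : HasFDerivAt (fun q : ℝ × ℝ => (n : ℝ) * q.1 - 1)
      ((n : ℝ) • ContinuousLinearMap.fst ℝ ℝ ℝ) p :=
    (hasFDerivAt_fst.const_mul (n : ℝ)).sub_const 1
  have a2 : HasFDerivAt (fun q : ℝ × ℝ => (n : ℝ) * q.2 - 1)
      ((n : ℝ) • ContinuousLinearMap.snd ℝ ℝ ℝ) p :=
    (hasFDerivAt_snd.const_mul (n : ℝ)).sub_const 1
  have b1 := (hd (n * p.1 - 1)).comp_hasFDerivAt p a1
  have b2 := (hd (n * p.2 - 1)).comp_hasFDerivAt p a2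
  have h : HasFDerivAt (cutoff n) _ p := b1.mul b2
  rw [h.fderiv]
  simp
  ring

theorem abs_fderiv_cutoff_le_left {C : ℝ} (hC : ∀ z, -1 ≤ z → |deriv Real.smoothTransition z| ≤ C)
    (n : ℕ) {p : ℝ × ℝ} (hp : 0 < p.1) : |fderiv ℝ (cutoff n) p (1, 0)| ≤ n * C := by
  have h1 : |deriv Real.smoothTransition (n * p.1 - 1)| ≤ C := hC _ (by
    have : 0 ≤ (n : ℝ) * p.1 := by positivity
    linarith)
  rw [fderiv_cutoff]
  simp only [mul_zero, zero_add, mul_one, abs_mul, Nat.abs_cast]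
  rw [abs_of_nonneg (Real.smoothTransition.nonneg _)]
  calc _ ≤ C * n * 1 := mul_le_mul (mul_le_mul_of_nonneg_right h1 (by positivity))
        (Real.smoothTransition.le_one _) (Real.smoothTransition.nonneg _)
        (mul_nonneg ((abs_nonneg _).trans h1) (by positivity))
    _ = n * C := by ring

theorem fderiv_cutoff_left_eq_zero {n : ℕ} {p : ℝ × ℝ} (hp : 2 < n * p.1) :
    fderiv ℝ (cutoff n) p (1, 0) = 0 := by
  rw [fderiv_cutoff, deriv_smoothTransition_of_one_lt (z := n * p.1 - 1) (by linarith)]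
  simp

theorem fderiv_cutoff_swap (n : ℕ) (p : ℝ × ℝ) :
    fderiv ℝ (cutoff n) p.swap (0, 1) = fderiv ℝ (cutoff n) p (1, 0) := by
  rw [fderiv_cutoff, fderiv_cutoff]
  simp only [Prod.fst_swap, Prod.snd_swap]
  ring

/-- On `Ω` the `x`-derivative of the cutoff is at most `n * C` and vanishes once `n * x > 2`, so the
strip `x < 3 / n` carries the whole integral. -/
theorem tendsto_lintegral_mul_fderiv_cutoff {a b : ℝ} (ha : 0 < a) {u : ℝ × ℝ → ℝ}
    (hu : AEMeasurable u (volume.restrict (rect a b))) {U : ℝ → L2Side b}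
    (hU : ContinuousOn U (Icc 0 a))
    (hUu : ∀ᵐ x ∂(volume : Measure ℝ).restrict (Ioo 0 a),
      ∀ᵐ y ∂(volume : Measure ℝ).restrict (Ioo 0 b), U x y = u (x, y))
    (hU0 : U 0 = 0) :
    Tendsto (fun n : ℕ => ∫⁻ p in rect a b, ‖u p * fderiv ℝ (cutoff n) p (1, 0)‖ₑ)
      atTop (𝓝 0) := by
  obtain ⟨C, hC0, hC⟩ := exists_abs_deriv_smoothTransition_le
  have h := tendsto_mul_lintegral_strip ha hu hU hUu hU0
  have h' := ENNReal.Tendsto.const_mul h (Or.inr (ENNReal.ofReal_ne_top (r := C)))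
  rw [mul_zero] at h'
  refine tendsto_of_tendsto_of_tendsto_of_le_of_le' tendsto_const_nhds h'
    (Eventually.of_forall fun _ => bot_le) ?_
  filter_upwards [eventually_gt_atTop 0] with n hn
  have hn' : (0 : ℝ) < n := by exact_mod_cast hn
  have hms : MeasurableSet (Ioo 0 (3 / (n : ℝ)) ×ˢ Ioo 0 b) :=
    measurableSet_Ioo.prod measurableSet_Ioo
  rw [← mul_assoc]
  calc ∫⁻ p in rect a b, ‖u p * fderiv ℝ (cutoff n) p (1, 0)‖ₑ
      ≤ ∫⁻ p in rect a b, (Ioo 0 (3 / (n : ℝ)) ×ˢ Ioo 0 b).indicator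
          (fun p => ENNReal.ofReal C * n * ‖u p‖ₑ) p := by
        refine setLIntegral_mono' (measurableSet_Ioo.prod measurableSet_Ioo) fun p hp => ?_
        by_cases hps : p.1 < 3 / n
        · have hmem : p ∈ Ioo 0 (3 / (n : ℝ)) ×ˢ Ioo 0 b := ⟨⟨hp.1.1, hps⟩, hp.2⟩
          rw [indicator_of_mem hmem, enorm_mul, mul_comm]
          gcongr
          rw [← ofReal_norm, Real.norm_eq_abs, mul_comm, ← ENNReal.ofReal_natCast,
            ← ENNReal.ofReal_mul (by positivity)]
          exact ENNReal.ofReal_le_ofReal (abs_fderiv_cutoff_le_left hC n hp.1.1)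
        · have : 2 < n * p.1 := by
            rw [not_lt, div_le_iff₀ hn'] at hps
            linarith
          rw [fderiv_cutoff_left_eq_zero this, mul_zero, enorm_zero]
          exact bot_le
    _ ≤ ∫⁻ p, (Ioo 0 (3 / (n : ℝ)) ×ˢ Ioo 0 b).indicator
          (fun p => ENNReal.ofReal C * n * ‖u p‖ₑ) p := setLIntegral_le_lintegral _ _
    _ = ENNReal.ofReal C * n * ∫⁻ p in Ioo 0 (3 / (n : ℝ)) ×ˢ Ioo 0 b, ‖u p‖ₑ := by
        rw [lintegral_indicator hms, lintegral_const_mul' _ _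
          (ENNReal.mul_ne_top ENNReal.ofReal_ne_top (ENNReal.natCast_ne_top n))]

theorem HasTraceLeft.tendsto_lintegral_mul_fderiv_cutoff {a b : ℝ} (ha : 0 < a) {u : L2 a b}
    (hu : HasTraceLeft a b u 0) :
    Tendsto (fun n : ℕ => ∫⁻ p in rect a b, ‖u p * fderiv ℝ (cutoff n) p (1, 0)‖ₑ)
      atTop (𝓝 0) := by
  obtain ⟨U, hU, hUu, hU0⟩ := hu
  exact RectangleSobolev.tendsto_lintegral_mul_fderiv_cutoff ha
    (Lp.aestronglyMeasurable u).aemeasurable hU hUu hU0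

/-- Exchanging the coordinates reduces this to the left side, since `cutoff` is symmetric. -/
theorem HasTraceBottom.tendsto_lintegral_mul_fderiv_cutoff {a b : ℝ} (hb : 0 < b) {u : L2 a b}
    (hu : HasTraceBottom a b u 0) :
    Tendsto (fun n : ℕ => ∫⁻ p in rect a b, ‖u p * fderiv ℝ (cutoff n) p (0, 1)‖ₑ)
      atTop (𝓝 0) := by
  obtain ⟨U, hU, hUu, hU0⟩ := hu
  have hmp : MeasurePreserving (Prod.swap : ℝ × ℝ → ℝ × ℝ) (volume.restrict (rect b a))
      (volume.restrict (rect a b)) := by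
    simp only [rect, Measure.volume_eq_prod, ← Measure.prod_restrict]
    exact Measure.measurePreserving_swap
  have hm : AEMeasurable (fun p : ℝ × ℝ => u p.swap) (volume.restrict (rect b a)) :=
    (Lp.aestronglyMeasurable u).aemeasurable.comp_quasiMeasurePreserving hmp.quasiMeasurePreserving
  refine (RectangleSobolev.tendsto_lintegral_mul_fderiv_cutoff hb hm hU hUu hU0).congr fun n => ?_
  have hemb : MeasurableEmbedding (Prod.swap : ℝ × ℝ → ℝ × ℝ) :=
    MeasurableEquiv.prodComm.measurableEmbedding
  rw [← hmp.lintegral_comp_emb hemb]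
  simp only [fderiv_cutoff_swap]

/-! ### Integration by parts against test functions that may cross `Γ`. -/

/-- Smooth, compactly supported functions whose support stays away from `x = L₁` and `y = L₂`. -/
def IsCornerTest (L₁ L₂ : ℝ) (ψ : ℝ × ℝ → ℝ) : Prop :=
  ContDiff ℝ ∞ ψ ∧ HasCompactSupport ψ ∧ tsupport ψ ⊆ Iio L₁ ×ˢ Iio L₂

theorem IsCornerTest.isTestFunction_cutoff_mul {L₁ L₂ : ℝ} {ψ : ℝ × ℝ → ℝ}
    (h : IsCornerTest L₁ L₂ ψ) (n : ℕ) : IsTestFunction L₁ L₂ (fun p => cutoff n p * ψ p) := by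
  refine ⟨(contDiff_cutoff n).mul h.1, h.2.1.mul_left, fun p hp => ?_⟩
  have h1 := tsupport_cutoff_subset n (tsupport_mul_subset_left hp)
  have h2 := h.2.2 (tsupport_mul_subset_right hp)
  have hn : (0 : ℝ) ≤ n := n.cast_nonneg
  refine ⟨⟨?_, h2.1⟩, ⟨?_, h2.2⟩⟩
  · by_contra hc
    nlinarith [h1.1, mul_nonneg hn (sub_nonneg.2 (not_lt.1 hc))]
  · by_contra hc
    nlinarith [h1.2, mul_nonneg hn (sub_nonneg.2 (not_lt.1 hc))]

/-- Test with `cutoff n * ψ` and let `n → ∞`. By the Leibniz rule, two terms converge by domination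
and the third, containing the derivative of the cutoff, tends to zero by `hb`. -/
theorem integral_mul_fderiv_of_cornerTest {L₁ L₂ : ℝ} {u v : L2 L₁ L₂} {e : ℝ × ℝ}
    (h : ∀ φ, IsTestFunction L₁ L₂ φ →
      ∫ p in rect L₁ L₂, u p * fderiv ℝ φ p e = -∫ p in rect L₁ L₂, v p * φ p)
    (hb : Tendsto (fun n : ℕ => ∫⁻ p in rect L₁ L₂, ‖u p * fderiv ℝ (cutoff n) p e‖ₑ)
      atTop (𝓝 0)) {ψ : ℝ × ℝ → ℝ} (hψ : IsCornerTest L₁ L₂ ψ) :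
    ∫ p in rect L₁ L₂, u p * fderiv ℝ ψ p e = -∫ p in rect L₁ L₂, v p * ψ p := by
  have hms : MeasurableSet (rect L₁ L₂) := measurableSet_Ioo.prod measurableSet_Ioo
  have hDc : Continuous fun p => fderiv ℝ ψ p e :=
    (hψ.1.continuous_fderiv (by simp)).clm_apply continuous_const
  have hDs : HasCompactSupport fun p => fderiv ℝ ψ p e := hψ.2.1.fderiv_apply ℝ e
  have hlim : ∀ {f : ℝ × ℝ → ℝ}, Integrable f (volume.restrict (rect L₁ L₂)) →
      Tendsto (fun n => ∫ p in rect L₁ L₂, cutoff n p * f p) atTop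
        (𝓝 (∫ p in rect L₁ L₂, f p)) := by
    intro f hf
    refine tendsto_integral_of_dominated_convergence (fun p => ‖f p‖)
      (fun n => (contDiff_cutoff n).continuous.aestronglyMeasurable.mul hf.1) hf.norm
      (fun n => ae_of_all _ fun p => ?_) ?_
    · rw [norm_mul, Real.norm_eq_abs, abs_of_nonneg (cutoff_nonneg n p)]
      exact mul_le_of_le_one_left (norm_nonneg _) (cutoff_le_one n p)
    · filter_upwards [ae_restrict_mem hms] with p hp
      simpa using (tendsto_cutoff hp.1.1 hp.2.1).mul_const (f p)
  have i1 := integrable_mul_of_test u hDc hDs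
  have i2 := integrable_mul_of_test v hψ.1.continuous hψ.2.1
  obtain ⟨C, hC⟩ := hψ.1.continuous.bounded_above_of_compact_support hψ.2.1
  have hC0 : 0 ≤ C := (norm_nonneg _).trans (hC 0)
  have hρc : ∀ n, Continuous fun p => fderiv ℝ (cutoff n) p e := fun n =>
    ((contDiff_cutoff n).continuous_fderiv (by simp)).clm_apply continuous_const
  have i3 : ∀ n, Integrable (fun p => u p * (fderiv ℝ (cutoff n) p e * ψ p))
      (volume.restrict (rect L₁ L₂)) := fun n =>
    integrable_mul_of_test u ((hρc n).mul hψ.1.continuous) hψ.2.1.mul_left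
  have l3 : Tendsto (fun n => ∫ p in rect L₁ L₂, u p * (fderiv ℝ (cutoff n) p e * ψ p))
      atTop (𝓝 0) := by
    have hb' := ENNReal.Tendsto.const_mul hb (Or.inr (ENNReal.ofReal_ne_top (r := C)))
    rw [mul_zero] at hb'
    rw [tendsto_zero_iff_enorm_tendsto_zero]
    refine tendsto_of_tendsto_of_tendsto_of_le_of_le tendsto_const_nhds hb'
      (fun _ => bot_le) fun n => ?_
    refine (enorm_integral_le_lintegral_enorm _).trans ?_
    rw [← lintegral_const_mul' _ _ ENNReal.ofReal_ne_top]
    refine lintegral_mono fun p => ?_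
    rw [← mul_assoc, enorm_mul, mul_comm]
    gcongr
    rw [← ofReal_norm]
    exact ENNReal.ofReal_le_ofReal (hC p)
  have key : ∀ n, (∫ p in rect L₁ L₂, cutoff n p * (u p * fderiv ℝ ψ p e))
      + ∫ p in rect L₁ L₂, u p * (fderiv ℝ (cutoff n) p e * ψ p)
      = -∫ p in rect L₁ L₂, cutoff n p * (v p * ψ p) := by
    intro n
    have i1' : Integrable (fun p => cutoff n p * (u p * fderiv ℝ ψ p e))
        (volume.restrict (rect L₁ L₂)) := by
      refine (integrable_mul_of_test u ((contDiff_cutoff n).continuous.mul hDc)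
        hDs.mul_left).congr (ae_of_all _ fun p => ?_)
      simp only [Pi.mul_apply]
      ring
    rw [← integral_add i1' (i3 n)]
    have := h _ (hψ.isTestFunction_cutoff_mul n)
    calc _ = ∫ p in rect L₁ L₂, u p * fderiv ℝ (fun p => cutoff n p * ψ p) p e := by
          refine integral_congr_ae (ae_of_all _ fun p => ?_)
          have d1 := ((contDiff_cutoff n).differentiable (by simp) p)
          have d2 := (hψ.1.differentiable (by simp) p)
          have := fderiv_fun_mul d1 d2
          simp only [this, _root_.add_apply, _root_.smul_apply,
            smul_eq_mul]
          ring
      _ = _ := by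
          rw [this]
          congr 1
          refine integral_congr_ae (ae_of_all _ fun p => ?_)
          ring
  have t1 := (hlim i1).add l3
  rw [add_zero] at t1
  exact tendsto_nhds_unique (t1.congr key) (hlim i2).neg

theorem IsTestFunction.fderiv_apply {L₁ L₂ : ℝ} {φ : ℝ × ℝ → ℝ} (h : IsTestFunction L₁ L₂ φ)
    (e : ℝ × ℝ) : IsTestFunction L₁ L₂ (fun p => fderiv ℝ φ p e) :=
  ⟨(h.1.fderiv_right (m := ∞) (by simp)).clm_apply contDiff_const, h.2.1.fderiv_apply ℝ e,
    (tsupport_fderiv_apply_subset ℝ e).trans h.2.2⟩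

theorem IsCornerTest.fderiv_apply {L₁ L₂ : ℝ} {φ : ℝ × ℝ → ℝ} (h : IsCornerTest L₁ L₂ φ)
    (e : ℝ × ℝ) : IsCornerTest L₁ L₂ (fun p => fderiv ℝ φ p e) :=
  ⟨(h.1.fderiv_right (m := ∞) (by simp)).clm_apply contDiff_const, h.2.1.fderiv_apply ℝ e,
    (tsupport_fderiv_apply_subset ℝ e).trans h.2.2⟩

theorem IsCornerTest.iterate_dy {L₁ L₂ : ℝ} {φ : ℝ × ℝ → ℝ} (h : IsCornerTest L₁ L₂ φ) (b : ℕ) :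
    IsCornerTest L₁ L₂ (dy^[b] φ) := by
  induction b with
  | zero => exact h
  | succ b ih =>
    rw [Function.iterate_succ_apply']
    exact ih.fderiv_apply (0, 1)

/-- Compare `hu` tested with `dx φ` and `hv` tested with `φ`. Because the second index is `0`, both
left sides agree by definition, without commuting derivatives. -/
theorem HasWeakDeriv.integral_mul_dx {L₁ L₂ : ℝ} {a : ℕ} {f u v : L2 L₁ L₂}
    (hu : HasWeakDeriv L₁ L₂ (a, 0) f u) (hv : HasWeakDeriv L₁ L₂ (a + 1, 0) f v)
    {φ : ℝ × ℝ → ℝ} (hφ : IsTestFunction L₁ L₂ φ) :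
    ∫ p in rect L₁ L₂, u p * dx φ p = -∫ p in rect L₁ L₂, v p * φ p := by
  have h1 : ∫ p in rect L₁ L₂, f p * partialD (a + 1, 0) φ p
      = (-1) ^ (a + 0) * ∫ p in rect L₁ L₂, u p * dx φ p := hu _ (hφ.fderiv_apply (1, 0))
  have h2 : ∫ p in rect L₁ L₂, f p * partialD (a + 1, 0) φ p
      = (-1) ^ (a + 1 + 0) * ∫ p in rect L₁ L₂, v p * φ p := hv _ hφ
  have h0 : ((-1 : ℝ)) ^ a ≠ 0 := pow_ne_zero _ (by norm_num)
  rw [h1] at h2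
  apply mul_left_cancel₀ h0
  rw [add_zero, add_zero, pow_succ] at h2
  rw [h2]
  ring

theorem HasWeakDeriv.integral_mul_dy {L₁ L₂ : ℝ} {a b : ℕ} {f u v : L2 L₁ L₂}
    (hu : HasWeakDeriv L₁ L₂ (a, b) f u) (hv : HasWeakDeriv L₁ L₂ (a, b + 1) f v)
    {φ : ℝ × ℝ → ℝ} (hφ : IsTestFunction L₁ L₂ φ) :
    ∫ p in rect L₁ L₂, u p * dy φ p = -∫ p in rect L₁ L₂, v p * φ p := by
  have h1 : ∫ p in rect L₁ L₂, f p * partialD (a, b + 1) φ p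
      = (-1) ^ (a + b) * ∫ p in rect L₁ L₂, u p * dy φ p := hu _ (hφ.fderiv_apply (0, 1))
  have h2 : ∫ p in rect L₁ L₂, f p * partialD (a, b + 1) φ p
      = (-1) ^ (a + (b + 1)) * ∫ p in rect L₁ L₂, v p * φ p := hv _ hφ
  have h0 : ((-1 : ℝ)) ^ (a + b) ≠ 0 := pow_ne_zero _ (by norm_num)
  rw [h1] at h2
  apply mul_left_cancel₀ h0
  rw [← add_assoc, pow_succ] at h2
  rw [h2]
  ring

/-- For a family of weak derivatives with vanishing traces on `Γ`, the defining identity extends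
to test functions that do not vanish on `Γ`. -/
theorem integral_mul_partialD_of_cornerTest {m : ℕ} {L₁ L₂ : ℝ} (hL₁ : 0 < L₁) (hL₂ : 0 < L₂)
    {F : ℕ × ℕ → L2 L₁ L₂}
    (hF : ∀ α : ℕ × ℕ, α.1 + α.2 ≤ m → HasWeakDeriv L₁ L₂ α (F (0, 0)) (F α))
    (hΓ : ∀ α : ℕ × ℕ, α.1 + α.2 < m → VanishesOnGamma L₁ L₂ (F α)) {α : ℕ × ℕ}
    (hα : α.1 + α.2 ≤ m) {ψ : ℝ × ℝ → ℝ} (hψ : IsCornerTest L₁ L₂ ψ) :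
    ∫ p in rect L₁ L₂, F (0, 0) p * partialD α ψ p
      = (-1) ^ (α.1 + α.2) * ∫ p in rect L₁ L₂, F α p * ψ p := by
  -- The path from `(0, 0)` to `α` goes through `(a, 0)` and then `(α.1, b)`. Each step starts at an
  -- index of order below `m`, where the trace condition is available.
  have hx : ∀ a : ℕ, a ≤ m → ∀ ψ : ℝ × ℝ → ℝ, IsCornerTest L₁ L₂ ψ →
      ∫ p in rect L₁ L₂, F (0, 0) p * dx^[a] ψ p
        = (-1) ^ a * ∫ p in rect L₁ L₂, F (a, 0) p * ψ p := by
    intro a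
    induction a with
    | zero => intro _ ψ _; simp
    | succ a ih =>
      intro ha ψ hψ
      have h1 := ih (by omega) (dx ψ) (hψ.fderiv_apply (1, 0))
      have h2 : ∫ p in rect L₁ L₂, F (a, 0) p * dx ψ p
          = -∫ p in rect L₁ L₂, F (a + 1, 0) p * ψ p :=
        integral_mul_fderiv_of_cornerTest
          (fun φ hφ => (hF (a, 0) (by simpa using by omega)).integral_mul_dx
            (hF (a + 1, 0) (by simpa using ha)) hφ)
          ((hΓ (a, 0) (by simpa using ha)).1.tendsto_lintegral_mul_fderiv_cutoff hL₁) hψ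
      rw [Function.iterate_succ_apply, h1, h2, pow_succ]
      ring
  have hy : ∀ a b : ℕ, a + b ≤ m → ∀ ψ : ℝ × ℝ → ℝ, IsCornerTest L₁ L₂ ψ →
      ∫ p in rect L₁ L₂, F (a, 0) p * dy^[b] ψ p
        = (-1) ^ b * ∫ p in rect L₁ L₂, F (a, b) p * ψ p := by
    intro a b
    induction b with
    | zero => intro _ ψ _; simp
    | succ b ih =>
      intro hb ψ hψ
      have h1 := ih (by omega) (dy ψ) (hψ.fderiv_apply (0, 1))
      have h2 : ∫ p in rect L₁ L₂, F (a, b) p * dy ψ p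
          = -∫ p in rect L₁ L₂, F (a, b + 1) p * ψ p :=
        integral_mul_fderiv_of_cornerTest
          (fun φ hφ => (hF (a, b) (by simpa using by omega)).integral_mul_dy
            (hF (a, b + 1) (by simpa using hb)) hφ)
          ((hΓ (a, b) (by simpa using by omega)).2.tendsto_lintegral_mul_fderiv_cutoff hL₂) hψ
      rw [Function.iterate_succ_apply, h1, h2, pow_succ]
      ring
  rw [partialD, hx α.1 (by omega) _ (hψ.iterate_dy α.2), hy α.1 α.2 hα ψ hψ, pow_add, mul_assoc]

/-! ### Smooth functions as elements of `H^m_Γ(Ω)`. -/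

theorem dx_dy_comm {φ : ℝ × ℝ → ℝ} (h : ContDiff ℝ ∞ φ) : dx (dy φ) = dy (dx φ) := by
  have h2 : Differentiable ℝ (fderiv ℝ φ) :=
    (h.fderiv_right (m := ∞) (by simp)).differentiable (by simp)
  have key : ∀ (e e' : ℝ × ℝ) p,
      fderiv ℝ (fun q => fderiv ℝ φ q e) p e' = fderiv ℝ (fderiv ℝ φ) p e' e := by
    intro e e' p
    rw [fderiv_clm_apply (h2 p) (differentiableAt_const e)]
    simp
  funext p
  have hs : IsSymmSndFDerivAt ℝ φ p :=
    h.contDiffAt.isSymmSndFDerivAt (by simpa using WithTop.coe_le_coe.2 (le_top : (2 : ℕ∞) ≤ ⊤))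
  exact (key (0, 1) (1, 0) p).trans ((hs (1, 0) (0, 1)).trans (key (1, 0) (0, 1) p).symm)

theorem contDiff_iterate_dx {φ : ℝ × ℝ → ℝ} (h : ContDiff ℝ ∞ φ) (a : ℕ) :
    ContDiff ℝ ∞ (dx^[a] φ) := by
  induction a with
  | zero => exact h
  | succ a ih => rw [Function.iterate_succ_apply']; exact contDiff_dx ih

theorem dy_iterate_dx {φ : ℝ × ℝ → ℝ} (h : ContDiff ℝ ∞ φ) (a : ℕ) :
    dy (dx^[a] φ) = dx^[a] (dy φ) := by
  induction a with
  | zero => rfl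
  | succ a ih =>
    rw [Function.iterate_succ_apply', Function.iterate_succ_apply', ← ih,
      dx_dy_comm (contDiff_iterate_dx h a)]

/-- Integrating by parts moves the derivatives over in reverse order; this restores the order used
in `partialD`. -/
theorem iterate_dy_iterate_dx {φ : ℝ × ℝ → ℝ} (h : ContDiff ℝ ∞ φ) (a b : ℕ) :
    dy^[b] (dx^[a] φ) = partialD (a, b) φ := by
  induction b generalizing φ with
  | zero => rfl
  | succ b ih =>
    rw [Function.iterate_succ_apply, dy_iterate_dx h, ih (contDiff_dy h)]
    rfl

/-- The support of `ψ` lies in `Ω`, so both integrals can be taken over the plane and there are no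
boundary terms. -/
theorem setIntegral_mul_fderiv {L₁ L₂ : ℝ} {φ ψ : ℝ × ℝ → ℝ} (hφ : ContDiff ℝ ∞ φ)
    (hψ : IsTestFunction L₁ L₂ ψ) (e : ℝ × ℝ) :
    ∫ p in rect L₁ L₂, φ p * fderiv ℝ ψ p e = -∫ p in rect L₁ L₂, fderiv ℝ φ p e * ψ p := by
  have hψ' := hψ.fderiv_apply e
  have hφ' : Continuous fun p => fderiv ℝ φ p e :=
    (hφ.continuous_fderiv (by simp)).clm_apply continuous_const
  have hz : ∀ {χ : ℝ × ℝ → ℝ}, IsTestFunction L₁ L₂ χ → ∀ p ∉ rect L₁ L₂, χ p = 0 :=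
    fun hχ p hp => image_eq_zero_of_notMem_tsupport fun h => hp (hχ.2.2 h)
  rw [setIntegral_eq_integral_of_forall_compl_eq_zero fun p hp => by rw [hz hψ' p hp, mul_zero],
    setIntegral_eq_integral_of_forall_compl_eq_zero fun p hp => by rw [hz hψ p hp, mul_zero]]
  exact integral_mul_fderiv_eq_neg_fderiv_mul_of_integrable
    ((hφ'.mul hψ.1.continuous).integrable_of_hasCompactSupport hψ.2.1.mul_left)
    ((hφ.continuous.mul hψ'.1.continuous).integrable_of_hasCompactSupport hψ'.2.1.mul_left)
    ((hφ.continuous.mul hψ.1.continuous).integrable_of_hasCompactSupport hψ.2.1.mul_left)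
    (fun p _ => hφ.differentiable (by simp) p) (fun p _ => hψ.1.differentiable (by simp) p)

theorem setIntegral_mul_iterate {L₁ L₂ : ℝ} {D : (ℝ × ℝ → ℝ) → ℝ × ℝ → ℝ} {e : ℝ × ℝ}
    (hD : ∀ φ p, D φ p = fderiv ℝ φ p e) (a : ℕ) {φ ψ : ℝ × ℝ → ℝ} (hφ : ContDiff ℝ ∞ φ)
    (hψ : IsTestFunction L₁ L₂ ψ) :
    ∫ p in rect L₁ L₂, φ p * D^[a] ψ p = (-1) ^ a * ∫ p in rect L₁ L₂, D^[a] φ p * ψ p := by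
  have hD' : ∀ φ, D φ = fun p => fderiv ℝ φ p e := fun φ => funext (hD φ)
  induction a generalizing φ ψ with
  | zero => simp
  | succ a ih =>
    have hφ' : ContDiff ℝ ∞ (D φ) := by
      rw [hD']
      exact (hφ.fderiv_right (m := ∞) (by simp)).clm_apply contDiff_const
    have hψ' : IsTestFunction L₁ L₂ (D^[a] ψ) := by
      clear ih
      induction a with
      | zero => exact hψ
      | succ a ih =>
        rw [Function.iterate_succ_apply', hD']
        exact ih.fderiv_apply e
    have h1 := setIntegral_mul_fderiv hφ hψ' e
    have h2 := ih hφ' hψ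
    simp only [← hD] at h1
    rw [Function.iterate_succ_apply', Function.iterate_succ_apply, h1, h2, pow_succ]
    ring

theorem hasWeakDeriv_of_contDiff {L₁ L₂ : ℝ} {φ : ℝ × ℝ → ℝ} (hφ : ContDiff ℝ ∞ φ) {α : ℕ × ℕ}
    {f g : L2 L₁ L₂} (hf : f =ᵐ[volume.restrict (rect L₁ L₂)] φ)
    (hg : g =ᵐ[volume.restrict (rect L₁ L₂)] partialD α φ) : HasWeakDeriv L₁ L₂ α f g := by
  intro ψ hψ
  have e1 : ∫ p in rect L₁ L₂, f p * partialD α ψ p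
      = ∫ p in rect L₁ L₂, φ p * partialD α ψ p :=
    integral_congr_ae (by filter_upwards [hf] with p hp; rw [hp])
  have e2 : ∫ p in rect L₁ L₂, g p * ψ p = ∫ p in rect L₁ L₂, partialD α φ p * ψ p :=
    integral_congr_ae (by filter_upwards [hg] with p hp; rw [hp])
  have hψ' : IsTestFunction L₁ L₂ (dy^[α.2] ψ) := by
    generalize α.2 = b
    induction b with
    | zero => exact hψ
    | succ b ih =>
      rw [Function.iterate_succ_apply']
      exact ih.fderiv_apply (0, 1)
  rw [e1, e2, partialD, setIntegral_mul_iterate (D := dx) (fun _ _ => rfl) α.1 hφ hψ',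
    setIntegral_mul_iterate (D := dy) (fun _ _ => rfl) α.2 (contDiff_iterate_dx hφ α.1) hψ,
    iterate_dy_iterate_dx hφ, pow_add, mul_assoc]

/-- Uniform continuity makes the slices depend continuously on `x` in the sup norm, hence in `L²` of
a bounded interval. -/
theorem exists_continuous_toLp_slices {φ : ℝ × ℝ → ℝ} (hc : Continuous φ)
    (hs : HasCompactSupport φ) (b : ℝ) :
    ∃ U : ℝ → L2Side b, Continuous U ∧
      ∀ x, U x =ᵐ[volume.restrict (Ioo 0 b)] fun y => φ (x, y) := by
  have hu : UniformContinuous φ := hs.uniformContinuous_of_continuous hc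
  obtain ⟨C, hC⟩ := hc.bounded_above_of_compact_support hs
  let B : ℝ → BoundedContinuousFunction ℝ ℝ := fun x =>
    BoundedContinuousFunction.ofNormedAddCommGroup (fun y => φ (x, y)) (by fun_prop) C
      fun y => hC (x, y)
  have hB : Continuous B := by
    refine Metric.continuous_iff.2 fun x ε hε => ?_
    obtain ⟨δ, hδ, h⟩ := Metric.uniformContinuous_iff.1 hu (ε / 2) (by positivity)
    refine ⟨δ, hδ, fun x' hx' => ?_⟩
    refine lt_of_le_of_lt ((BoundedContinuousFunction.dist_le (by positivity)).2 fun y => ?_)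
      (half_lt_self hε)
    refine (h (a := (x', y)) (b := (x, y)) ?_).le
    rw [Prod.dist_eq, dist_self]
    exact max_lt hx' hδ
  refine ⟨fun x => BoundedContinuousFunction.toLp 2 (volume.restrict (Ioo 0 b)) ℝ (B x),
    (BoundedContinuousFunction.toLp 2 (volume.restrict (Ioo 0 b)) ℝ).continuous.comp hB,
    fun x => ?_⟩
  exact BoundedContinuousFunction.coeFn_toLp 2 (volume.restrict (Ioo 0 b)) ℝ (B x)

theorem vanishesOnGamma_of_continuous {L₁ L₂ : ℝ} {φ : ℝ × ℝ → ℝ}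
    (hc : Continuous φ) (hs : HasCompactSupport φ) (hx : ∀ y ∈ Ioo 0 L₂, φ (0, y) = 0)
    (hy : ∀ x ∈ Ioo 0 L₁, φ (x, 0) = 0) {f : L2 L₁ L₂}
    (hf : f =ᵐ[volume.restrict (rect L₁ L₂)] φ) : VanishesOnGamma L₁ L₂ f := by
  constructor
  · obtain ⟨U, hU, hUφ⟩ := exists_continuous_toLp_slices hc hs L₂
    refine ⟨U, hU.continuousOn, ?_, ?_⟩
    · filter_upwards [ae_ae_left hf] with x h
      filter_upwards [h, hUφ x] with y h1 h2
      rw [h1, h2]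
    · refine Lp.ext ?_
      filter_upwards [hUφ 0, Lp.coeFn_zero ℝ 2 ((volume : Measure ℝ).restrict (Ioo 0 L₂)),
        ae_restrict_mem measurableSet_Ioo] with y h1 h2 h3
      rw [h1, h2, hx y h3, Pi.zero_apply]
  · have hs' : HasCompactSupport fun p : ℝ × ℝ => φ p.swap :=
      hs.comp_homeomorph (Homeomorph.prodComm ℝ ℝ)
    obtain ⟨U, hU, hUφ⟩ := exists_continuous_toLp_slices (hc.comp continuous_swap) hs' L₁
    refine ⟨U, hU.continuousOn, ?_, ?_⟩
    · filter_upwards [ae_ae_bottom hf] with y h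
      filter_upwards [h, hUφ y] with x h1 h2
      rw [h1, h2]
      rfl
    · refine Lp.ext ?_
      filter_upwards [hUφ 0, Lp.coeFn_zero ℝ 2 ((volume : Measure ℝ).restrict (Ioo 0 L₁)),
        ae_restrict_mem measurableSet_Ioo] with x h1 h2 h3
      rw [h1, h2, Pi.zero_apply]
      exact hy x h3

theorem tsupport_partialD_subset (α : ℕ × ℕ) (φ : ℝ × ℝ → ℝ) :
    tsupport (partialD α φ) ⊆ tsupport φ := by
  have hy : ∀ b : ℕ, tsupport (dy^[b] φ) ⊆ tsupport φ := by
    intro b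
    induction b with
    | zero => exact subset_rfl
    | succ b ih =>
      rw [Function.iterate_succ_apply']
      exact (tsupport_fderiv_apply_subset ℝ (0, 1)).trans ih
  have hx : ∀ a b : ℕ, tsupport (dx^[a] (dy^[b] φ)) ⊆ tsupport φ := by
    intro a b
    induction a with
    | zero => exact hy b
    | succ a ih =>
      rw [Function.iterate_succ_apply']
      exact (tsupport_fderiv_apply_subset ℝ (1, 0)).trans ih
  exact hx α.1 α.2

/-- All derivatives of `φ` vanish off its support, in particular on `Γ`; the complement of the
support is the required neighborhood. -/
theorem exists_smoothVanishingInH (m : ℕ) {L₁ L₂ δ : ℝ} (hδ : 0 < δ) {φ : ℝ × ℝ → ℝ}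
    (hφ : ContDiff ℝ ∞ φ) (hc : HasCompactSupport φ)
    (hs : tsupport φ ⊆ {p | δ ≤ p.1 ∧ δ ≤ p.2}) :
    ∃ Θ ∈ smoothVanishingInH m L₁ L₂, ∀ α : multiIdx m,
      weakD Θ.1 α =ᵐ[volume.restrict (rect L₁ L₂)] partialD α φ := by
  have hLp : ∀ α : ℕ × ℕ, MemLp (partialD α φ) 2 (volume.restrict (rect L₁ L₂)) := fun α =>
    (partialD_regular α hφ hc).1.continuous.memLp_of_hasCompactSupport (partialD_regular α hφ hc).2
  let F : PiLp 2 fun _ : multiIdx m => L2 L₁ L₂ := WithLp.toLp 2 fun α => (hLp α).toLp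
  have hF : ∀ α : multiIdx m, F α =ᵐ[volume.restrict (rect L₁ L₂)] partialD α φ :=
    fun α => (hLp α).coeFn_toLp
  have hF0 : F (zeroIdx m) =ᵐ[volume.restrict (rect L₁ L₂)] φ := hF (zeroIdx m)
  have hzero : ∀ (α : ℕ × ℕ) (p : ℝ × ℝ), p.1 < δ ∨ p.2 < δ → partialD α φ p = 0 := by
    intro α p hp
    refine image_eq_zero_of_notMem_tsupport fun h => ?_
    have h' := hs (tsupport_partialD_subset α φ h)
    exact hp.elim h'.1.not_gt h'.2.not_gt
  let Θ₀ : sobolevH m L₁ L₂ := ⟨F, fun α => hasWeakDeriv_of_contDiff hφ hF0 (hF α)⟩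
  let Θ : sobolevHGamma m L₁ L₂ := ⟨Θ₀, fun α _ =>
    vanishesOnGamma_of_continuous (partialD_regular α hφ hc).1.continuous
      (partialD_regular α hφ hc).2 (fun y _ => hzero α _ (Or.inl hδ))
      (fun x _ => hzero α _ (Or.inr hδ)) (hF α)⟩
  refine ⟨Θ, ⟨φ, ⟨hφ, (tsupport φ)ᶜ, (isClosed_tsupport φ).isOpen_compl, ?_, ?_⟩, hF0⟩, hF⟩
  · intro p hp h
    have h' := hs h
    rcases hp.2 with h0 | h0
    · linarith [h'.1]
    · linarith [h'.2]
  · exact fun p hp => image_eq_zero_of_notMem_tsupport hp.1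

/-! ### Mollification with kernels shifted into the quadrant `x, y > 0`. -/

/-- The convolution of `g` with the kernel `η`. -/
noncomputable def mollify (g η : ℝ × ℝ → ℝ) (p : ℝ × ℝ) : ℝ := ∫ t, g t * η (p - t)

theorem mollify_eq_convolution (g η : ℝ × ℝ → ℝ) :
    mollify g η = convolution g η (ContinuousLinearMap.mul ℝ ℝ) volume := rfl

theorem fderiv_mollify {g η : ℝ × ℝ → ℝ} (hg : LocallyIntegrable g volume)
    (hη : ContDiff ℝ ∞ η) (hc : HasCompactSupport η) (p e : ℝ × ℝ) :
    fderiv ℝ (mollify g η) p e = mollify g (fun q => fderiv ℝ η q e) p := by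
  rw [mollify_eq_convolution, (hc.hasFDerivAt_convolution_right (ContinuousLinearMap.mul ℝ ℝ) hg
    (hη.of_le (by simp)) p).fderiv,
    convolution_precompR_apply _ hg (hc.fderiv ℝ) (hη.continuous_fderiv (by simp))]
  rfl

theorem partialD_mollify {g η : ℝ × ℝ → ℝ} (hg : LocallyIntegrable g volume)
    (hη : ContDiff ℝ ∞ η) (hc : HasCompactSupport η) (α : ℕ × ℕ) :
    partialD α (mollify g η) = mollify g (partialD α η) := by
  have hy : ∀ b : ℕ, dy^[b] (mollify g η) = mollify g (dy^[b] η) := by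
    intro b
    induction b with
    | zero => rfl
    | succ b ih =>
      have hr := partialD_regular (0, b) hη hc
      rw [Function.iterate_succ_apply', Function.iterate_succ_apply', ih]
      exact funext fun p => fderiv_mollify hg hr.1 hr.2 p (0, 1)
  have hx : ∀ a b : ℕ, dx^[a] (dy^[b] (mollify g η)) = mollify g (dx^[a] (dy^[b] η)) := by
    intro a b
    induction a with
    | zero => exact hy b
    | succ a ih =>
      have hr := partialD_regular (a, b) hη hc
      rw [Function.iterate_succ_apply', Function.iterate_succ_apply', ih]
      exact funext fun p => fderiv_mollify hg hr.1 hr.2 p (1, 0)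
  exact hx α.1 α.2

theorem contDiff_mollify {g η : ℝ × ℝ → ℝ} (hg : LocallyIntegrable g volume)
    (hη : ContDiff ℝ ∞ η) (hc : HasCompactSupport η) : ContDiff ℝ ∞ (mollify g η) :=
  hc.contDiff_convolution_right (n := ⊤) (ContinuousLinearMap.mul ℝ ℝ) hg hη

theorem fderiv_comp_sub {η : ℝ × ℝ → ℝ} (hη : ContDiff ℝ ∞ η) (c : ℝ) (p t e : ℝ × ℝ) :
    fderiv ℝ (fun q => c * η (p - q)) t e = -c * fderiv ℝ η (p - t) e := by
  have h1 : HasFDerivAt (fun q : ℝ × ℝ => p - q) (-ContinuousLinearMap.id ℝ (ℝ × ℝ)) t :=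
    (hasFDerivAt_id t).const_sub p
  have h2 := (((hη.differentiable (by simp) (p - t)).hasFDerivAt.comp t h1).const_mul c).fderiv
  have h3 : fderiv ℝ (fun q => c * η (p - q)) t = _ := h2
  rw [h3]
  simp

theorem partialD_comp_sub {η : ℝ × ℝ → ℝ} (hη : ContDiff ℝ ∞ η) (hc : HasCompactSupport η)
    (α : ℕ × ℕ) (p : ℝ × ℝ) :
    partialD α (fun t => η (p - t)) = fun t => (-1) ^ (α.1 + α.2) * partialD α η (p - t) := by
  have hy : ∀ b : ℕ, dy^[b] (fun t => η (p - t)) = fun t => (-1) ^ b * dy^[b] η (p - t) := by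
    intro b
    induction b with
    | zero => simp
    | succ b ih =>
      rw [Function.iterate_succ_apply', Function.iterate_succ_apply', ih]
      funext t
      have := fderiv_comp_sub (partialD_regular (0, b) hη hc).1 ((-1) ^ b) p t (0, 1)
      refine this.trans ?_
      rw [pow_succ, mul_neg_one]
      rfl
  have hx : ∀ a b : ℕ, dx^[a] (dy^[b] (fun t => η (p - t)))
      = fun t => (-1) ^ (a + b) * dx^[a] (dy^[b] η) (p - t) := by
    intro a b
    induction a with
    | zero => simpa using hy b
    | succ a ih =>
      rw [Function.iterate_succ_apply', Function.iterate_succ_apply', ih]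
      funext t
      have := fderiv_comp_sub (partialD_regular (a, b) hη hc).1 ((-1) ^ (a + b)) p t (1, 0)
      refine this.trans ?_
      rw [add_right_comm, pow_succ, mul_neg_one]
      rfl
  exact hx α.1 α.2

/-- Mollification kernels supported in the square `[δ, 3δ]²`. -/
theorem exists_corner_kernel {δ : ℝ} (hδ : 0 < δ) :
    ∃ η : ℝ × ℝ → ℝ, ContDiff ℝ ∞ η ∧ HasCompactSupport η ∧ (∀ t, 0 ≤ η t) ∧ ∫ t, η t = 1 ∧
      ∀ p ∈ tsupport η, δ ≤ p.1 ∧ δ ≤ p.2 ∧ ‖p‖ ≤ 3 * δ := by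
  -- Balls of `ℝ × ℝ` are squares (sup norm): the closed ball of radius `δ` about `(2δ, 2δ)` is `[δ,
  -- 3δ]²`.
  let f : ContDiffBump ((2 * δ, 2 * δ) : ℝ × ℝ) := ⟨δ / 2, δ, by positivity, by linarith⟩
  refine ⟨f.normed volume, f.contDiff_normed (n := ⊤), f.hasCompactSupport_normed,
    f.nonneg_normed, f.integral_normed, fun p hp => ?_⟩
  rw [f.tsupport_normed_eq, Metric.mem_closedBall, Prod.dist_eq, max_le_iff, Real.dist_eq,
    Real.dist_eq, abs_le, abs_le] at hp
  change (-δ ≤ p.1 - 2 * δ ∧ p.1 - 2 * δ ≤ δ) ∧ (-δ ≤ p.2 - 2 * δ ∧ p.2 - 2 * δ ≤ δ) at hp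
  refine ⟨by linarith, by linarith, ?_⟩
  rw [Prod.norm_def, max_le_iff, Real.norm_eq_abs, Real.norm_eq_abs, abs_le, abs_le]
  refine ⟨⟨?_, ?_⟩, ⟨?_, ?_⟩⟩ <;> linarith

theorem tsupport_mollify_subset {L₁ L₂ δ : ℝ} {g η : ℝ × ℝ → ℝ}
    (hg : ∀ t ∉ rect L₁ L₂, g t = 0) (hη : ∀ p ∈ tsupport η, δ ≤ p.1 ∧ δ ≤ p.2) :
    tsupport (mollify g η) ⊆ {p | δ ≤ p.1 ∧ δ ≤ p.2} := by
  refine closure_minimal (fun p hp => ?_) ?_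
  · by_contra hc
    refine hp (integral_eq_zero_of_ae (ae_of_all _ fun t => ?_))
    by_cases ht : t ∈ rect L₁ L₂
    · have : η (p - t) = 0 := by
        refine image_eq_zero_of_notMem_tsupport fun h => hc ?_
        have h' := hη _ h
        rw [Prod.fst_sub, Prod.snd_sub] at h'
        exact ⟨by linarith [ht.1.1], by linarith [ht.2.1]⟩
      simp [this]
    · simp [hg t ht]
  · exact (isClosed_le continuous_const continuous_fst).inter
      (isClosed_le continuous_const continuous_snd)

/-- On the support, `t` lies at least `δ` below `p` in each coordinate, which keeps it away from
`L₁` and `L₂`. It may leave `Ω` through `Γ`. -/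
theorem isCornerTest_comp_sub {L₁ L₂ δ : ℝ} (hδ : 0 < δ) {η : ℝ × ℝ → ℝ} (hη : ContDiff ℝ ∞ η)
    (hc : HasCompactSupport η) (hs : ∀ p ∈ tsupport η, δ ≤ p.1 ∧ δ ≤ p.2) {p : ℝ × ℝ}
    (hp : p ∈ rect L₁ L₂) : IsCornerTest L₁ L₂ (fun t => η (p - t)) := by
  refine ⟨hη.comp (contDiff_const.sub contDiff_id),
    hc.comp_homeomorph (Homeomorph.subLeft p), fun t ht => ?_⟩
  have h1 : p - t ∈ tsupport η :=
    tsupport_comp_subset_preimage η (f := fun t : ℝ × ℝ => p - t) (by fun_prop) ht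
  have h2 := hs _ h1
  rw [Prod.fst_sub, Prod.snd_sub] at h2
  exact ⟨show t.1 < L₁ by linarith [hp.1.2], show t.2 < L₂ by linarith [hp.2.2]⟩

theorem measurableSet_rect (L₁ L₂ : ℝ) : MeasurableSet (rect L₁ L₂) :=
  measurableSet_Ioo.prod measurableSet_Ioo

theorem mollify_indicator {L₁ L₂ : ℝ} (f η : ℝ × ℝ → ℝ) (p : ℝ × ℝ) :
    mollify ((rect L₁ L₂).indicator f) η p = ∫ t in rect L₁ L₂, f t * η (p - t) := by
  rw [mollify, ← integral_indicator (measurableSet_rect L₁ L₂)]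
  refine integral_congr_ae (ae_of_all _ fun t => ?_)
  by_cases ht : t ∈ rect L₁ L₂ <;> simp [ht]

theorem memLp_indicator_rect {L₁ L₂ : ℝ} (f : L2 L₁ L₂) :
    MemLp ((rect L₁ L₂).indicator f) 2 volume :=
  (memLp_indicator_iff_restrict (measurableSet_rect L₁ L₂)).2 (Lp.memLp f)

theorem locallyIntegrable_indicator_rect {L₁ L₂ : ℝ} (f : L2 L₁ L₂) :
    LocallyIntegrable ((rect L₁ L₂).indicator f) volume :=
  (memLp_indicator_rect f).locallyIntegrable (by norm_num)

theorem hasCompactSupport_indicator_rect {L₁ L₂ : ℝ} (f : ℝ × ℝ → ℝ) :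
    HasCompactSupport ((rect L₁ L₂).indicator f) := by
  refine HasCompactSupport.intro' (K := Icc 0 L₁ ×ˢ Icc 0 L₂) (isCompact_Icc.prod isCompact_Icc)
    (isClosed_Icc.prod isClosed_Icc) fun t ht => indicator_of_notMem (fun h => ht ?_) _
  exact ⟨Ioo_subset_Icc_self h.1, Ioo_subset_Icc_self h.2⟩

/-- Put all derivatives on `η`, then move them to `θ` by the extended weak identity tested with `t ↦
η (p - t)`. The sign from reflecting `η` cancels the sign of that identity. -/
theorem partialD_mollify_eq_mollify {m : ℕ} {L₁ L₂ : ℝ} (hL₁ : 0 < L₁) (hL₂ : 0 < L₂)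
    (θ : sobolevHGamma m L₁ L₂) {δ : ℝ} (hδ : 0 < δ) {η : ℝ × ℝ → ℝ} (hη : ContDiff ℝ ∞ η)
    (hc : HasCompactSupport η) (hs : ∀ p ∈ tsupport η, δ ≤ p.1 ∧ δ ≤ p.2) (α : multiIdx m)
    {p : ℝ × ℝ} (hp : p ∈ rect L₁ L₂) :
    partialD α (mollify ((rect L₁ L₂).indicator (toL2 θ.1)) η) p
      = mollify ((rect L₁ L₂).indicator (weakD θ.1 α)) η p := by
  -- The value `0` for orders above `m` is a filler that is never used.
  let F : ℕ × ℕ → L2 L₁ L₂ := fun β => if h : β ∈ multiIdx m then weakD θ.1 ⟨β, h⟩ else 0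
  have hF : ∀ (β : ℕ × ℕ) (h : β ∈ multiIdx m), F β = weakD θ.1 ⟨β, h⟩ := fun β h => dif_pos h
  have hF0 : F (0, 0) = toL2 θ.1 := hF (0, 0) (zeroIdx m).2
  have hFw : ∀ β : ℕ × ℕ, β.1 + β.2 ≤ m → HasWeakDeriv L₁ L₂ β (F (0, 0)) (F β) := by
    intro β hβ
    rw [hF0, hF β (mem_multiIdx.2 hβ)]
    exact θ.1.2 ⟨β, mem_multiIdx.2 hβ⟩
  have hFΓ : ∀ β : ℕ × ℕ, β.1 + β.2 < m → VanishesOnGamma L₁ L₂ (F β) := by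
    intro β hβ
    rw [hF β (mem_multiIdx.2 hβ.le)]
    exact θ.2 ⟨β, mem_multiIdx.2 hβ.le⟩ hβ
  have h := integral_mul_partialD_of_cornerTest hL₁ hL₂ hFw hFΓ (mem_multiIdx.1 α.2)
    (isCornerTest_comp_sub hδ hη hc hs hp)
  rw [partialD_comp_sub hη hc, hF0, hF α α.2] at h
  rw [partialD_mollify (locallyIntegrable_indicator_rect _) hη hc, mollify_indicator,
    mollify_indicator]
  have h0 : ((-1 : ℝ)) ^ (α.1.1 + α.1.2) ≠ 0 := pow_ne_zero _ (by norm_num)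
  apply mul_left_cancel₀ h0
  rw [← h, ← integral_const_mul]
  refine integral_congr_ae (ae_of_all _ fun t => ?_)
  exact mul_left_comm _ _ _

/-! ### Approximation and density. -/

/-- One mollification of `θ` serves every `α` and `ε` at once; the error in each derivative is
controlled by its own modulus of continuity under translations of size at most `3 * δ`. -/
theorem exists_approximation {m : ℕ} {L₁ L₂ : ℝ} (hL₁ : 0 < L₁) (hL₂ : 0 < L₂)
    (θ : sobolevHGamma m L₁ L₂) {δ : ℝ} (hδ : 0 < δ) :
    ∃ Θ ∈ smoothVanishingInH m L₁ L₂, ∀ (α : multiIdx m) (ε : ℝ≥0∞),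
      (∀ t : ℝ × ℝ, ‖t‖ ≤ 3 * δ → eLpNorm (fun p => (rect L₁ L₂).indicator (weakD θ.1 α) (p - t)
        - (rect L₁ L₂).indicator (weakD θ.1 α) p) 2 volume ≤ ε) →
      eLpNorm (weakD Θ.1 α - weakD θ.1 α : ℝ × ℝ → ℝ) 2 (volume.restrict (rect L₁ L₂)) ≤ ε := by
  obtain ⟨η, hη, hηc, hη0, hη1, hηs⟩ := exists_corner_kernel hδ
  have hηs' : ∀ p ∈ tsupport η, δ ≤ p.1 ∧ δ ≤ p.2 := fun p hp => ⟨(hηs p hp).1, (hηs p hp).2.1⟩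
  have hms := measurableSet_rect L₁ L₂
  have hΦ := contDiff_mollify (locallyIntegrable_indicator_rect (toL2 θ.1)) hη hηc
  have hΦc : HasCompactSupport (mollify ((rect L₁ L₂).indicator (toL2 θ.1)) η) :=
    (hasCompactSupport_indicator_rect _).convolution (ContinuousLinearMap.mul ℝ ℝ) hηc
  obtain ⟨Θ, hΘ, hΘD⟩ := exists_smoothVanishingInH m (L₁ := L₁) (L₂ := L₂) hδ hΦ hΦc
    (tsupport_mollify_subset (fun t ht => indicator_of_notMem ht _) hηs')
  refine ⟨Θ, hΘ, fun α ε hε => ?_⟩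
  have hle := eLpNorm_convolution_sub_le
    ((Lp.stronglyMeasurable (weakD θ.1 α)).measurable.indicator hms)
    (locallyIntegrable_indicator_rect _) hη.continuous hηc hη0 hη1 (ε := ε)
    fun t ht => hε t (hηs t (subset_tsupport η ht)).2.2
  -- The estimate `hle` holds on the plane, but the derivative is identified with the mollified weak
  -- derivative on `Ω` only.
  refine le_trans (le_of_eq ?_) ((eLpNorm_mono_measure _ (Measure.restrict_le_self (s := rect L₁ L₂))).trans hle)
  refine eLpNorm_congr_ae ?_
  filter_upwards [hΘD α, ae_restrict_mem hms] with p h1 h2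
  rw [Pi.sub_apply, h1, partialD_mollify_eq_mollify hL₁ hL₂ θ hδ hη hηc hηs' α h2,
    indicator_of_mem h2]
  rfl

end RectangleSobolev

open RectangleSobolev in
theorem mainTheorem6 (m : ℕ) (L₁ L₂ : ℝ) (hL₁ : 0 < L₁) (hL₂ : 0 < L₂) :
    Dense (RectangleSobolev.smoothVanishingInH m L₁ L₂) := by
  intro θ
  choose Θ hΘ hΘε using fun n : ℕ => exists_approximation hL₁ hL₂ θ (Nat.one_div_pos_of_nat (n := n))
  refine mem_closure_of_tendsto (f := Θ) (b := atTop) ?_ (Eventually.of_forall hΘ)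
  rw [tendsto_subtype_rng, tendsto_subtype_rng]
  suffices h : ∀ α : multiIdx m, Tendsto (fun n => weakD (Θ n).1 α) atTop (𝓝 (weakD θ.1 α)) from
    ((PiLp.continuous_toLp 2 _).tendsto (fun α => weakD θ.1 α)).comp (tendsto_pi_nhds.2 h)
  intro α
  rw [Lp.tendsto_Lp_iff_tendsto_eLpNorm', ENNReal.tendsto_nhds_zero]
  intro ε hε
  have ht := tendsto_eLpNorm_translate_sub (memLp_indicator_rect (weakD θ.1 α))
  obtain ⟨r, hr, hrε⟩ := Metric.eventually_nhds_iff.1 (ENNReal.tendsto_nhds_zero.1 ht ε hε)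
  -- With `δ = 1 / (n + 1) < r / 3`, all translations occurring have norm at most `3 * δ < r`.
  filter_upwards [tendsto_one_div_add_atTop_nhds_zero_nat.eventually
    (gt_mem_nhds (show (0 : ℝ) < r / 3 by positivity))] with n hn
  refine hΘε n α ε fun t ht => hrε ?_
  rw [dist_zero_right]
  linarith
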